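/- Conventions. Graphs are finite and may have loops and parallel edges; $M(G)$ is the cycle matroid of $G$ on its edge set, and a matroid is graphic if it equals $M(G)$ for some graph $G$. All matroids are finite. For matroids $M,N$ on the same ground set, $N$ is a lift of $M$ if every flat of $M$ is a flat of $N$. A flag matroid is a sequence $(M_1,\dots,M_k)$ of matroids on one ground set $E$ such that each $M_{i+1}$ is a lift of $M_i$ and $M_{i+1}\neq M_i$; it is full if $\operatorname{rank}(M_{i+1})=\operatorname{rank}(M_i)+1$ for all $i<k$. A lift witness sequence of it is a sequence of matroids $(Q_1,\dots,Q_{k-1})$, with $Q_i$ on a disjoint union $E\sqcup X_i$, such that $X_i$ is independent in $Q_i$, $Q_i/X_i=M_i$ and $Q_i\setminus X_i=M_{i+1}$. A flag matroid is graphic if there are a graph $G$ with edge set $E$ and partitions $\mathcal P_1,\dots,\mathcal P_k$ of its vertex set, each $\mathcal P_{i+1}$ refining (or equal to) $\mathcal P_i$, such that for every $i$, $M_i$ is the cycle matroid of the graph obtained from $G$ by identifying the vertices in each cell of $\mathcal P_i$ (keeping all edges, labelled, possibly as loops or parallel edges). Let $H_1,H_2,G_3$ be the graphs on vertex sets $\{0,1,2\}$,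 $\{0,1,2,3\}$, $\{0,1,2,3,4\}$ whose common edge set is $\{e_0,\dots,e_8\}$, the ends of $e_0,\dots,e_8$ being, in this order, $$H_1:\ 02,\,01,\,00,\,12,\,12,\,12,\,02,\,02,\,01;$$ $$H_2:\ 03,\,01,\,00,\,12,\,13,\,13,\,02,\,02,\,01;$$ $$G_3:\ 01,\,04,\,24,\,03,\,12,\,14,\,34,\,23,\,02.$$ (So $G_3$ is $K_5$ minus the edge $13$, the graph $H_1$ is $H_2$ with $2$ and $3$ identified, and $M(H_2)=M(G_2)$, where $G_2$ is $G_3$ with $2$ and $4$ identified.) Proposition. $\mathfrak F=(M(H_1),M(H_2),M(G_3))$ is a full flag matroid. It has a lift witness sequence, and for every lift witness sequence $(Q_1,Q_2)$ of $\mathfrak F$ both $Q_1$ and $Q_2$ are graphic matroids; but $\mathfrak F$ is not a graphic flag matroid. In particular, there exists a full flag matroid such that every member of its lift witness sequence is graphic but which is not itself graphic. -/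

import Mathlib

namespace FlagMatroid

/-! ### Cycle matroids of (multi)graphs -/

/-- `C` is the edge set of a cycle of `G`: a closed walk `v₀ e₀ v₁ e₁ … vₙ eₙ v₀` with distinct
vertices and distinct edges. For `n = 0` this is a loop, for `n = 1` a pair of parallel edges.
(Addition in `Fin (n + 1)` is cyclic.) -/
def IsCycle {V E : Type*} (G : Graph V E) (C : Set E) : Prop :=
  ∃ (n : ℕ) (v : Fin (n + 1) → V) (e : Fin (n + 1) → E),
    Function.Injective v ∧ Function.Injective e ∧
    (∀ i, G.IsLink (e i) (v i) (v (i + 1))) ∧ C = Set.range e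

/-- `M` is the cycle matroid `M(G)`: its ground set is the edge set of `G`, and a set of edges is
independent iff it contains no cycle. (These properties determine `M`.) -/
def IsCycleMatroid {V E : Type*} (G : Graph V E) (M : Matroid E) : Prop :=
  M.E = G.edgeSet ∧ ∀ I ⊆ G.edgeSet, (M.Indep I ↔ ∀ C ⊆ I, ¬ IsCycle G C)

/-- A matroid is graphic if it is the cycle matroid of a finite graph. -/
def IsGraphic {E : Type*} (M : Matroid E) : Prop :=
  ∃ (V : Type) (_ : Finite V) (G : Graph V E), IsCycleMatroid G M

/-! ### Flag matroids -/

/-- `N` is a lift of `M` (and `M` a quotient of `N`): same ground set, and every flat of `M` is a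
flat of `N`. -/
def IsLift {α : Type*} (N M : Matroid α) : Prop :=
  N.E = M.E ∧ ∀ F, M.IsFlat F → N.IsFlat F

/-- A flag matroid, given by its sequence of matroids `M 0, …, M k` on a finite ground set: each
is a nontrivial lift of the preceding one. -/
structure IsFlagMatroid {α : Type*} {k : ℕ} (M : Fin (k + 1) → Matroid α) : Prop where
  finite : ∀ i, (M i).E.Finite
  isLift : ∀ i : Fin k, IsLift (M i.succ) (M i.castSucc)
  nontrivial : ∀ i : Fin k, M i.succ ≠ M i.castSucc

/-- A full flag matroid: consecutive ranks differ by exactly one. -/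
def IsFullFlagMatroid {α : Type*} {k : ℕ} (M : Fin (k + 1) → Matroid α) : Prop :=
  IsFlagMatroid M ∧ ∀ i : Fin k, (M i.succ).eRank = (M i.castSucc).eRank + 1

/-- A flag matroid is graphic if there are a finite graph `G` and a chain of partitions
`P 0 ≻ P 1 ≻ … ≻ P k` of its vertices (each one finer than, or equal to, the preceding one) such
that `M i` is the cycle matroid of the graph obtained from `G` by identifying the vertices in each
cell of `P i`. The edges keep their labels, so edges may become loops or parallel. -/
def IsGraphicFlagMatroid {α : Type*} {k : ℕ} (M : Fin (k + 1) → Matroid α) : Prop :=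
  ∃ (V : Type) (_ : Finite V) (G : Graph V α) (P : Fin (k + 1) → Setoid V),
    (∀ i : Fin k, P i.succ ≤ P i.castSucc) ∧
    ∀ i, IsCycleMatroid (G.map (Quotient.mk (P i))) (M i)

/-- `(Q 0, …, Q (k - 1))` is a lift witness sequence of the flag matroid `(M 0, …, M k)`, where
`Q i` is a finite matroid on the disjoint union of the common ground set and a set `X i` that is
independent in `Q i`, with `Q i / X i = M i` and `Q i \ X i = M (i + 1)`. The disjoint union is
taken inside the sum type `α ⊕ β`. -/
structure IsLiftWitnessSeq {α β : Type*} {k : ℕ} (M : Fin (k + 1) → Matroid α)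
    (X : Fin k → Set β) (Q : Fin k → Matroid (α ⊕ β)) : Prop where
  finite : ∀ i, (X i).Finite
  ground : ∀ i, (Q i).E = Sum.inl '' (M i.castSucc).E ∪ Sum.inr '' X i
  indep : ∀ i, (Q i).Indep (Sum.inr '' X i)
  contract : ∀ i, (Q i).contract (Sum.inr '' X i) =
    (M i.castSucc).map Sum.inl Sum.inl_injective.injOn
  delete : ∀ i, (Q i).delete (Sum.inr '' X i) =
    (M i.succ).map Sum.inl Sum.inl_injective.injOn

/-! ### The three graphs -/

/-- The graph with vertex type `V` and edge type `E` in which `e` has the ends `ends e`. -/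
def graphOfEnds {V E : Type*} (ends : E → Sym2 V) : Graph V E where
  vertexSet := Set.univ
  IsLink e x y := ends e = s(x, y)
  isLink_symm _ _ := ⟨fun _ _ h => h.trans Sym2.eq_swap⟩
  eq_or_eq_of_isLink_of_isLink := by
    intro e x y v w h h'
    rcases Sym2.eq_iff.1 (h.symm.trans h') with h | h
    · exact Or.inl h.1
    · exact Or.inr h.1
  left_mem_of_isLink _ _ _ _ := Set.mem_univ _

/-- `G₃`: the complete graph on `0, 1, 2, 3, 4` without the edge joining `1` and `3`.
The two vertices to be identified for passing to the quotient `M(H₂)` are `2` and `4`. -/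
def graphG3 : Graph (Fin 5) (Fin 9) :=
  graphOfEnds ![s(0, 1), s(0, 4), s(2, 4), s(0, 3), s(1, 2), s(1, 4), s(3, 4), s(2, 3), s(0, 2)]

/-- `H₂`: edges labelled so that `M(H₂) = M(G₂)`, where `G₂` is `G₃` with `2` and `4` identified. -/
def graphH2 : Graph (Fin 4) (Fin 9) :=
  graphOfEnds ![s(0, 3), s(0, 1), s(0, 0), s(1, 2), s(1, 3), s(1, 3), s(0, 2), s(0, 2), s(0, 1)]

/-- `H₁`: obtained from `H₂` by identifying the vertices `2` and `3`. -/
def graphH1 : Graph (Fin 3) (Fin 9) :=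
  graphOfEnds ![s(0, 2), s(0, 1), s(0, 0), s(1, 2), s(1, 2), s(1, 2), s(0, 2), s(0, 2), s(0, 1)]

end FlagMatroid

namespace FlagMatroid
open Finsupp (single)

/-! Everything is carried out with incidence vectors over the field with two elements: a set of
edges is acyclic iff its vectors are independent, and identifying vertices applies a linear map.
Linear images give quotients, so both lift relations follow once each lower matroid is realized by
identifying two vertices in a graph of the next one.

For `M(H₁)` and `M(H₂)` the identification is in `H₂`; for `M(H₂)` and `M(G₃)` it is in `G₃`, whose
quotient `G₂` differs from `H₂` by a Whitney twist (`cycleMatroid_endsH2`). A new edge `p` between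
the two vertices to be identified gives a witness: deleting `p` returns the graph, contracting `p`
identifies the vertices.

An arbitrary witness is not much freer. The ranks differ by one, so `Q / (E \ X)` has rank `|X| -
1`: it consists of one circuit `C` and coloops (`exists_series_class`). This determines `Q` from the
two given matroids and `C`. Subdividing `p` into a path with edge set `C` and adding pendant edges
for `X \ C` gives a graph of `Q` (`exists_ends_of_series_class`, `isGraphic_of_witness`).

The flag is not graphic because the two steps use graphs on opposite sides of the twist. In a graph
with matroid `M(G₃)`, triangles force edges 0, 1, 3 to share a vertex `u`, while 6 joins the other
ends of 1 and 3. In `M(H₁)` edges 0 and 6 are parallel, so an identification yielding it must merge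
`u` with an end of 6, which makes 1 or 3 a loop; neither is one in `M(H₁)`
(`not_isCycleMatroid_map`). -/

/-! ### Cycles and binary incidence vectors -/

/-- The column of the vertex-edge incidence matrix over the field with two elements that belongs to
an edge with the given ends; it vanishes for a loop. -/
noncomputable def incidence {V : Type*} (p : V × V) : V →₀ ZMod 2 :=
  single p.1 1 + single p.2 1

lemma incidence_swap {V : Type*} (a b : V) : incidence (a, b) = incidence (b, a) := by
  simp [incidence, add_comm]

lemma incidence_apply {V : Type*} [DecidableEq V] (p : V × V) (v : V) :
    incidence p v = (if p.1 = v then 1 else 0) + (if p.2 = v then 1 else 0) := by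
  simp [incidence, Finsupp.single_apply]

lemma incidence_self {V : Type*} (a : V) : incidence (a, a) = 0 := by
  simp [incidence, ← Finsupp.single_add, CharTwo.add_self_eq_zero]

lemma lmapDomain_incidence {V W : Type*} (f : V → W) (p : V × V) :
    Finsupp.lmapDomain (ZMod 2) (ZMod 2) f (incidence p) = incidence (f p.1, f p.2) := by
  simp [incidence, Finsupp.mapDomain_add]

/-- Over the field with two elements, a family is independent iff no nonempty finite subfamily sums
to zero. -/
lemma linearIndepOn_zmod_two_iff {E W : Type*} [AddCommGroup W] [Module (ZMod 2) W] {φ : E → W}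
    {I : Set E} : LinearIndepOn (ZMod 2) φ I ↔
      ∀ T : Finset E, (T : Set E) ⊆ I → ∑ e ∈ T, φ e = 0 → T = ∅ := by
  classical
  rw [linearIndepOn_iff']
  constructor
  · intro h T hT hs
    by_contra hne
    obtain ⟨e, he⟩ := Finset.nonempty_iff_ne_empty.2 hne
    exact one_ne_zero (h T (fun _ => 1) hT (by simpa using hs) e he)
  · intro h t g ht hs i hi
    by_contra hgi
    have key : ∀ a : ZMod 2, a ≠ 0 → a = 1 := by decide
    have h0 := h (t.filter fun e => g e ≠ 0)
      (fun e he => ht (Finset.mem_filter.1 he).1) (by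
        rw [← hs, Finset.sum_filter]
        refine Finset.sum_congr rfl fun e _ => ?_
        by_cases hg : g e = 0
        · simp [hg]
        · simp [key _ hg])
    exact Finset.notMem_empty i (h0 ▸ Finset.mem_filter.2 ⟨hi, hgi⟩)

/-- Each vertex of a cycle begins one edge and ends one, so the incidence vectors sum to zero modulo
two; loops (`n = 0`) are included. -/
lemma IsCycle.not_linearIndepOn {V E : Type*} {G : Graph V E} {ends : E → V × V}
    (hG : ∀ e ∈ G.edgeSet, G.IsLink e (ends e).1 (ends e).2) {C I : Set E} (hC : IsCycle G C)
    (hCI : C ⊆ I) : ¬ LinearIndepOn (ZMod 2) (fun e => incidence (ends e)) I := by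
  classical
  rw [linearIndepOn_zmod_two_iff]
  intro h
  obtain ⟨n, v, e, -, he, hl, rfl⟩ := hC
  have hvec : ∀ i, incidence (ends (e i)) = single (v i) 1 + single (v (i + 1)) 1 := by
    intro i
    rcases (hG _ (hl i).edge_mem).eq_and_eq_or_eq_and_eq (hl i) with h | h
    · simp [incidence, h.1, h.2]
    · simp [incidence, h.1, h.2, add_comm]
  have := h (Finset.univ.image e) (by simpa using hCI) (by
    rw [Finset.sum_image he.injOn]
    simp only [hvec, Finset.sum_add_distrib]
    rw [Fintype.sum_equiv (Equiv.addRight (1 : Fin (n + 1))) (fun i => single (v (i + 1)) (1 : ZMod 2))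
      (fun i => single (v i) 1) (fun i => rfl), ← Finset.sum_add_distrib]
    refine Finset.sum_eq_zero fun i _ => ?_
    rw [← Finsupp.single_add, CharTwo.add_self_eq_zero, Finsupp.single_zero])
  exact Finset.univ_nonempty.ne_empty (Finset.image_eq_empty.1 this)

/-- An infinite walk without immediate reversals and without loops that visits only finitely many
vertices runs through a cycle. -/
lemma exists_isCycle_of_walk {V E : Type*} {G : Graph V E} {w : ℕ → V} {e : ℕ → E}
    (hw : (Set.range w).Finite) (hl : ∀ i, G.IsLink (e i) (w i) (w (i + 1)))
    (hne : ∀ i, e (i + 1) ≠ e i) : ∃ C ⊆ Set.range e, IsCycle G C := by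
  classical
  -- Some vertex recurs. The gap is written `d + 1` to be positive; the segment between a closest
  -- pair of equal vertices will be the cycle.
  have hrep : ∃ d, ∃ i, w i = w (i + (d + 1)) := by
    have : ¬ Function.Injective w := fun h => (Set.infinite_range_of_injective h) hw
    simp only [Function.Injective, not_forall] at this
    obtain ⟨a, b, hab, hne⟩ := this
    rcases lt_or_gt_of_ne hne with h | h
    · exact ⟨b - a - 1, a, by rw [hab]; congr 1; omega⟩
    · exact ⟨a - b - 1, b, by rw [← hab]; congr 1; omega⟩
  obtain ⟨i, hi⟩ := Nat.find_spec hrep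
  set d := Nat.find hrep with hd
  have hmin : ∀ a b, a < b → b - a < d + 1 → w a ≠ w b := by
    intro a b hab hlt h
    refine Nat.find_min hrep (m := b - a - 1) (by omega) ⟨a, ?_⟩
    rw [h]; congr 1; omega
  have hmin' : ∀ a b, a ≤ d → b ≤ d → w (i + a) = w (i + b) → a = b := by
    intro a b ha hb h
    rcases lt_trichotomy a b with hab | hab | hab
    · exact absurd h (hmin _ _ (by omega) (by omega))
    · exact hab
    · exact absurd h.symm (hmin _ _ (by omega) (by omega))
  -- A repeated edge traversed in the same direction repeats a vertex too early; traversed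
  -- backwards, it forces `b = a + 1`, an immediate reversal.
  have hedge : ∀ a b, a < b → b ≤ d → e (i + a) ≠ e (i + b) := by
    intro a b hab hb h
    have h1 := hl (i + a)
    rw [h] at h1
    rcases h1.eq_and_eq_or_eq_and_eq (hl (i + b)) with ⟨h2, -⟩ | ⟨h2, h3⟩
    · exact absurd (hmin' a b (by omega) hb h2) (by omega)
    · have hb' := hmin' (a + 1) b (by omega) hb h3
      subst hb'
      exact hne (i + a) h.symm
  refine ⟨Set.range fun k : Fin (d + 1) => e (i + k), ?_, d, fun k => w (i + k),
    fun k => e (i + k), ?_, ?_, ?_, rfl⟩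
  · rintro _ ⟨k, rfl⟩
    exact ⟨_, rfl⟩
  · intro a b h
    exact Fin.ext (hmin' _ _ (by omega) (by omega) h)
  · intro a b h
    rcases lt_trichotomy a b with hab | hab | hab
    · exact absurd h (hedge _ _ hab (by omega))
    · exact hab
    · exact absurd h.symm (hedge _ _ hab (by omega))
  · intro k
    have := hl (i + k)
    rcases eq_or_ne k (Fin.last d) with rfl | hk
    · simp only [Fin.val_last, Fin.last_add_one, Fin.val_zero, add_zero] at this ⊢
      rw [hi]
      exact this
    · have hv := Fin.val_add_one_of_lt (Fin.lt_last_iff_ne_last.2 hk)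
      simp only [hv]
      exact this

/-- The cycle space of a graph is generated by cycles: a nonempty finite set of edges that meets
every vertex evenly contains a cycle. -/
lemma exists_isCycle_of_sum_eq_zero {V E : Type*} {G : Graph V E} {ends : E → V × V}
    {T : Finset E} (hG : ∀ e ∈ T, G.IsLink e (ends e).1 (ends e).2) (hT : T.Nonempty)
    (hs : ∑ e ∈ T, incidence (ends e) = 0) : ∃ C ⊆ (T : Set E), IsCycle G C := by
  classical
  by_cases hloop : ∃ e ∈ T, (ends e).1 = (ends e).2
  · obtain ⟨e, heT, he⟩ := hloop
    refine ⟨{e}, by simpa using heT, 0, fun _ => (ends e).1, fun _ => e,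
      fun i j _ => Fin.ext (by omega), fun i j _ => Fin.ext (by omega), fun i => ?_, by simp⟩
    have := hG e heT
    rwa [← he] at this
  push Not at hloop
  have hnz : ∀ e v, e ∈ T → incidence (ends e) v ≠ 0 → ∃ w, G.IsLink e v w := by
    intro e v he h
    rw [incidence_apply] at h
    by_cases h1 : (ends e).1 = v
    · exact ⟨_, h1 ▸ hG e he⟩
    by_cases h2 : (ends e).2 = v
    · exact ⟨_, (h2 ▸ hG e he).symm⟩
    simp [h1, h2] at h
  have hlink : ∀ e v w, e ∈ T → G.IsLink e v w → incidence (ends e) w = 1 := by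
    intro e v w he h
    have hne := hloop e he
    rcases (hG e he).eq_and_eq_or_eq_and_eq h with ⟨h1, h2⟩ | ⟨h1, h2⟩
    · rw [incidence_apply, if_neg (h2 ▸ hne), if_pos h2, zero_add]
    · rw [incidence_apply, if_pos h1, if_neg (h1 ▸ hne.symm), add_zero]
  -- A state is a directed edge of `T`. It can always be continued by another edge: if `e` were the
  -- only edge of `T` at its head `w`, the sum would have coordinate one there.
  have hstep : ∀ s : {s : V × E × V // s.2.1 ∈ T ∧ G.IsLink s.2.1 s.1 s.2.2},
      ∃ t : {s : V × E × V // s.2.1 ∈ T ∧ G.IsLink s.2.1 s.1 s.2.2},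
        t.1.1 = s.1.2.2 ∧ t.1.2.1 ≠ s.1.2.1 := by
    rintro ⟨⟨v, e, w⟩, he, hl⟩
    dsimp only at he hl
    by_contra hcon
    have hz : ∀ f ∈ T, f ≠ e → incidence (ends f) w = 0 := by
      intro f hf hfe
      by_contra h
      obtain ⟨x, hx⟩ := hnz f w hf h
      exact hcon ⟨⟨(w, f, x), hf, hx⟩, rfl, hfe⟩
    have := DFunLike.congr_fun hs w
    rw [Finsupp.finsetSum_apply, Finset.sum_eq_single_of_mem e he hz, hlink e v w he hl] at this
    exact one_ne_zero this
  choose next hnext hnext' using hstep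
  obtain ⟨e₀, he₀⟩ := hT
  let s : ℕ → {s : V × E × V // s.2.1 ∈ T ∧ G.IsLink s.2.1 s.1 s.2.2} := fun n =>
    next^[n] ⟨((ends e₀).1, e₀, (ends e₀).2), he₀, hG e₀ he₀⟩
  have hs' : ∀ n, s (n + 1) = next (s n) := fun n => Function.iterate_succ_apply' _ _ _
  obtain ⟨C, hC, hcyc⟩ : ∃ C ⊆ Set.range fun n => (s n).1.2.1, IsCycle G C := by
    refine exists_isCycle_of_walk (w := fun n => (s n).1.1) ?_ ?_ ?_
    · refine ((T.image fun e => (ends e).1) ∪ (T.image fun e => (ends e).2)).finite_toSet.subset ?_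
      rintro _ ⟨n, rfl⟩
      have h1 := (s n).2
      rcases (hG _ h1.1).eq_and_eq_or_eq_and_eq h1.2 with h | h
      · simp only [Finset.coe_union, Finset.coe_image]
        exact Or.inl ⟨_, h1.1, h.1⟩
      · simp only [Finset.coe_union, Finset.coe_image]
        exact Or.inr ⟨_, h1.1, h.2⟩
    · intro n
      have h1 := (s n).2.2
      have h2 := hnext (s n)
      rw [← hs'] at h2
      simp only [h2]
      exact h1
    · intro n
      simp only [hs']
      exact hnext' (s n)
  refine ⟨C, hC.trans ?_, hcyc⟩
  rintro _ ⟨n, rfl⟩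
  exact (s n).2.1

/-- Acyclic sets of edges are the sets of edges with independent incidence vectors. -/
lemma forall_not_isCycle_iff {V E : Type*} {G : Graph V E} {ends : E → V × V}
    (hG : ∀ e ∈ G.edgeSet, G.IsLink e (ends e).1 (ends e).2) {I : Set E} (hI : I ⊆ G.edgeSet) :
    (∀ C ⊆ I, ¬ IsCycle G C) ↔ LinearIndepOn (ZMod 2) (fun e => incidence (ends e)) I := by
  refine ⟨fun h => ?_, fun h C hCI hC => hC.not_linearIndepOn hG hCI h⟩
  rw [linearIndepOn_zmod_two_iff]
  intro T hT hs
  by_contra hne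
  obtain ⟨C, hC, hcyc⟩ := exists_isCycle_of_sum_eq_zero (G := G)
    (fun e he => hG e (hI (hT he))) (Finset.nonempty_iff_ne_empty.2 hne) hs
  exact h C (hC.trans hT) hcyc

/-- A matroid represented by the incidence vectors of a finite graph is graphic. -/
lemma isGraphic_of_linearIndepOn {V : Type} {E : Type*} [Finite V] {M : Matroid E}
    (ends : E → V × V) (h : ∀ I ⊆ M.E, M.Indep I ↔
      LinearIndepOn (ZMod 2) (fun e => incidence (ends e)) I) : IsGraphic M := by
  let G : Graph V E :=
    { vertexSet := Set.univ
      IsLink := fun e x y => e ∈ M.E ∧ s((ends e).1, (ends e).2) = s(x, y)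
      isLink_symm := fun e he => ⟨fun x y hxy => ⟨hxy.1, hxy.2.trans Sym2.eq_swap⟩⟩
      eq_or_eq_of_isLink_of_isLink := by
        intro e x y v w hx hv
        rcases Sym2.eq_iff.1 (hx.2.symm.trans hv.2) with h | h
        · exact Or.inl h.1
        · exact Or.inr h.1
      left_mem_of_isLink := fun _ _ _ _ => Set.mem_univ _ }
  have hE : G.edgeSet = M.E := by
    ext e
    rw [Graph.edgeSet_eq_setOfPred_exists_isLink]
    exact ⟨fun ⟨x, y, hxy⟩ => hxy.1, fun he => ⟨_, _, he, rfl⟩⟩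
  refine ⟨V, inferInstance, G, hE.symm, fun I hI => ?_⟩
  rw [h I (hE ▸ hI), forall_not_isCycle_iff (G := G) (ends := ends) (fun e he => ⟨hE ▸ he, rfl⟩) hI]

/-! ### Represented matroids, contraction and identification of vertices -/

/-- The matroid represented by a finite family of vectors. -/
noncomputable def vectorMatroid (K : Type*) {E W : Type*} [Field K] [AddCommGroup W] [Module K W]
    [Finite E] (φ : E → W) : Matroid E :=
  (IndepMatroid.ofFinite (E := Set.univ) Set.finite_univ (fun I => LinearIndepOn K φ I)
    (linearIndepOn_empty K φ) (fun _ _ hJ hIJ => hJ.mono hIJ)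
    (by
      intro I J hI hJ hlt
      by_contra! hcon
      have hsub : φ '' J ⊆ Submodule.span K (φ '' I) := by
        rintro _ ⟨e, he, rfl⟩
        by_contra hspan
        have heI : e ∉ I := fun h => hspan (Submodule.subset_span ⟨e, h, rfl⟩)
        exact hcon e he heI (hI.insert hspan)
      have := Fintype.ofFinite (φ '' I)
      have := Fintype.ofFinite J
      have hle := linearIndependent_le_span' _ hJ (φ '' I) (by rwa [← Set.image_eq_range])
      rw [Cardinal.mk_fintype, Nat.cast_le, ← Nat.card_eq_fintype_card, ← Nat.card_eq_fintype_card] at hle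
      have := Set.ncard_image_le (f := φ) I.toFinite
      exact absurd hle (by rw [Nat.card_coe_set_eq, Nat.card_coe_set_eq]; omega))
    (fun _ _ => Set.subset_univ _)).matroid

@[simp] lemma vectorMatroid_ground (K : Type*) {E W : Type*} [Field K] [AddCommGroup W]
    [Module K W] [Finite E] (φ : E → W) : (vectorMatroid K φ).E = Set.univ := rfl

@[simp] lemma vectorMatroid_indep_iff {K E W : Type*} [Field K] [AddCommGroup W]
    [Module K W] [Finite E] {φ : E → W} {I : Set E} :
    (vectorMatroid K φ).Indep I ↔ LinearIndepOn K φ I := Iff.rfl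

/-- Up to an injective map, `L` is the quotient by the line of `φ y`, and passing to that quotient
is contracting `y`. -/
lemma linearIndepOn_insert_iff_comp {K E U W : Type*} [Field K] [AddCommGroup U] [Module K U]
    [AddCommGroup W] [Module K W] {φ : E → U} {L : U →ₗ[K] W} {y : E} {J : Set E} (hy : φ y ≠ 0)
    (hyJ : y ∉ J) (hL : LinearMap.ker L = Submodule.span K {φ y}) :
    LinearIndepOn K φ (insert y J) ↔ LinearIndepOn K (L ∘ φ) J := by
  have h1 : LinearIndepOn K φ {y} := LinearIndepOn.singleton hy
  have hcomp : L ∘ φ = ((LinearMap.ker L).liftQ L le_rfl) ∘ ((LinearMap.ker L).mkQ ∘ φ) := by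
    ext e; simp
  have hinj : Function.Injective ((LinearMap.ker L).liftQ L le_rfl) :=
    LinearMap.ker_eq_bot.1 (Submodule.ker_liftQ_eq_bot _ _ _ le_rfl)
  rw [← Set.singleton_union, ← h1.quotient_iff_union (Set.disjoint_singleton_left.2 hyJ),
    Set.image_singleton, ← hL, hcomp]
  exact (LinearMap.linearIndepOn_iff_of_injOn _ hinj.injOn).symm

/-- Identifying the two ends of an edge kills exactly the incidence vector of that edge. -/
lemma ker_lmapDomain_eq_span_incidence {V W : Type*} {f : V → W} {s : W → V} {p : V × V}
    (hf : f p.1 = f p.2) (hs : ∀ v, s (f v) = v ∨ v = p.1 ∧ s (f v) = p.2) :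
    LinearMap.ker (Finsupp.lmapDomain (ZMod 2) (ZMod 2) f) =
      Submodule.span (ZMod 2) {incidence p} := by
  apply le_antisymm
  · intro x hx
    -- For `x` in the kernel the subtracted term vanishes, so `x` itself lies in the span. On basis
    -- vectors, `s ∘ f` moves at most `p.1`, and that to `p.2`.
    have key : ∀ x : V →₀ ZMod 2, x - Finsupp.lmapDomain (ZMod 2) (ZMod 2) s
        (Finsupp.lmapDomain (ZMod 2) (ZMod 2) f x) ∈ Submodule.span (ZMod 2) {incidence p} := by
      intro x
      induction x using Finsupp.induction_linear with
      | zero => simp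
      | add x y hx hy =>
        rw [map_add, map_add, add_sub_add_comm]
        exact add_mem hx hy
      | single v c =>
        simp only [Finsupp.lmapDomain_apply, Finsupp.mapDomain_single]
        rcases hs v with h | ⟨h1, h2⟩
        · simp [h]
        · refine Submodule.mem_span_singleton.2 ⟨c, ?_⟩
          rw [h2, h1, incidence, sub_eq_add_neg, ← Finsupp.single_neg, ZMod.neg_eq_self_mod_two]
          simp
    simpa [LinearMap.mem_ker.1 hx] using key x
  · rw [Submodule.span_singleton_le_iff_mem, LinearMap.mem_ker, lmapDomain_incidence, hf,
      incidence_self]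

lemma incidence_ne_zero {V : Type*} {p : V × V} (h : p.1 ≠ p.2) : incidence p ≠ 0 := by
  classical
  intro h0
  have := DFunLike.congr_fun h0 p.1
  simp [incidence_apply, h.symm] at this

/-- Contraction of a nonloop edge of a graph: identify its ends. -/
lemma linearIndepOn_incidence_insert_iff {V W E : Type*} {f : V → W} {s : W → V}
    {ends : E → V × V} {y : E} {J : Set E} (hne : (ends y).1 ≠ (ends y).2)
    (hf : f (ends y).1 = f (ends y).2)
    (hs : ∀ v, s (f v) = v ∨ v = (ends y).1 ∧ s (f v) = (ends y).2) (hyJ : y ∉ J) :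
    LinearIndepOn (ZMod 2) (fun e => incidence (ends e)) (insert y J) ↔
      LinearIndepOn (ZMod 2) (fun e => incidence (f (ends e).1, f (ends e).2)) J := by
  rw [linearIndepOn_insert_iff_comp (φ := fun e => incidence (ends e)) (incidence_ne_zero hne) hyJ
    (ker_lmapDomain_eq_span_incidence hf hs)]
  simp only [Function.comp_def, lmapDomain_incidence]

lemma linearIndepOn_incidence_map_iff {V W E : Type*} {f : V → W} (hf : Function.Injective f)
    {ends : E → V × V} {J : Set E} :
    LinearIndepOn (ZMod 2) (fun e => incidence (f (ends e).1, f (ends e).2)) J ↔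
      LinearIndepOn (ZMod 2) (fun e => incidence (ends e)) J := by
  simp only [← lmapDomain_incidence]
  exact LinearMap.linearIndepOn_iff_of_injOn (Finsupp.lmapDomain (ZMod 2) (ZMod 2) f)
    (Finsupp.mapDomain_injective hf).injOn

lemma linearIndepOn_incidence_congr {V E : Type*} {ends ends' : E → V × V} {J : Set E}
    (h : ∀ e ∈ J, ends e = ends' e) :
    LinearIndepOn (ZMod 2) (fun e => incidence (ends e)) J ↔
      LinearIndepOn (ZMod 2) (fun e => incidence (ends' e)) J :=
  linearIndepOn_congr fun e he => by simp [h e he]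

/-! ### Series and pendant edges -/

/-- Subdividing the edge `z` of a graph, so that `y` becomes an edge in series with `z`. -/
lemma exists_ends_series {V : Type} {E : Type*} (ends : E → V × V) {y z : E}
    (hyz : y ≠ z) : ∃ ends' : E → Option V × Option V, ∀ I : Set E,
      (y ∈ I → (LinearIndepOn (ZMod 2) (fun e => incidence (ends' e)) I ↔
        LinearIndepOn (ZMod 2) (fun e => incidence (ends e)) (I \ {y}))) ∧
      (y ∉ I → (LinearIndepOn (ZMod 2) (fun e => incidence (ends' e)) I ↔
        LinearIndepOn (ZMod 2) (fun e => incidence (ends e)) (I \ {z}))) := by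
  classical
  -- The new vertex `none` splits `z` into the halves `y` and `z`; the old ends of `y` are
  -- discarded. Contracting the half `y` restores the old `z`, reversed; without `y`, the half `z`
  -- is pendant and can be dropped.
  let ends' : E → Option V × Option V := fun e =>
    if e = y then (none, some (ends z).2) else if e = z then (none, some (ends z).1)
    else (some (ends e).1, some (ends e).2)
  have hy : ends' y = (none, some (ends z).2) := by simp [ends']
  have hz : ends' z = (none, some (ends z).1) := by simp [ends', hyz.symm]
  have he : ∀ e, e ≠ y → e ≠ z → ends' e = (some (ends e).1, some (ends e).2) := by
    intro e h1 h2
    simp [ends', h1, h2]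
  refine ⟨ends', fun I => ⟨fun hyI => ?_, fun hyI => ?_⟩⟩
  · conv_lhs => rw [← Set.insert_sdiff_self_of_mem hyI]
    rw [linearIndepOn_incidence_insert_iff (ends := ends') (f := fun v => v.getD (ends z).2) (s := some)
        (by simp [hy]) (by simp [hy]) (by rw [hy]; rintro (_ | v) <;> simp) (by simp)]
    trans LinearIndepOn (ZMod 2) (fun e => incidence
      ((fun e => if e = z then ((ends z).2, (ends z).1) else ends e) e)) (I \ {y})
    · refine linearIndepOn_incidence_congr fun e h => ?_
      by_cases hez : e = z
      · simp [hez, hz]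
      · simp [he e h.2 hez, hez]
    · refine linearIndepOn_congr fun e _ => ?_
      by_cases hez : e = z
      · simp [hez, incidence_swap]
      · simp [hez]
  · by_cases hzI : z ∈ I
    · conv_lhs => rw [← Set.insert_sdiff_self_of_mem hzI]
      rw [linearIndepOn_incidence_insert_iff (ends := ends') (f := fun v => v.getD (ends z).1) (s := some)
          (by simp [hz]) (by simp [hz]) (by rw [hz]; rintro (_ | v) <;> simp) (by simp)]
      refine linearIndepOn_incidence_congr fun e h => ?_
      simp [he e (fun h' => hyI (h' ▸ h.1)) h.2]
    · rw [Set.sdiff_singleton_eq_self hzI,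
        ← linearIndepOn_incidence_map_iff (Option.some_injective V)]
      exact linearIndepOn_incidence_congr fun e h =>
        he e (fun h' => hyI (h' ▸ h)) (fun h' => hzI (h' ▸ h))

/-- Replacing `y` by a pendant edge. -/
lemma exists_ends_coloop {V : Type} {E : Type*} (ends : E → V × V) (y : E) :
    ∃ ends' : E → Option V × Option V, ∀ I : Set E,
      LinearIndepOn (ZMod 2) (fun e => incidence (ends' e)) I ↔
        LinearIndepOn (ZMod 2) (fun e => incidence (ends e)) (I \ {y}) := by
  classical
  let ends' : E → Option V × Option V := fun e =>
    if e = y then (none, some (ends y).1) else (some (ends e).1, some (ends e).2)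
  have hy : ends' y = (none, some (ends y).1) := by simp [ends']
  have he : ∀ e, e ≠ y → ends' e = (some (ends e).1, some (ends e).2) := by
    intro e h1
    simp [ends', h1]
  refine ⟨ends', fun I => ?_⟩
  by_cases hyI : y ∈ I
  · conv_lhs => rw [← Set.insert_sdiff_self_of_mem hyI]
    rw [linearIndepOn_incidence_insert_iff (ends := ends') (f := fun v => v.getD (ends y).1) (s := some)
        (by simp [hy]) (by simp [hy]) (by rw [hy]; rintro (_ | v) <;> simp) (by simp)]
    refine linearIndepOn_incidence_congr fun e h => ?_
    simp [he e h.2]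
  · rw [Set.sdiff_singleton_eq_self hyI,
      ← linearIndepOn_incidence_map_iff (Option.some_injective V)]
    exact linearIndepOn_incidence_congr fun e h => he e (fun h' => hyI (h' ▸ h))

/-! ### The structure of arbitrary witnesses -/

/-- If the deletion of `X` has rank one more than the contraction of the independent set `X`, then
`X` consists of a series class `C` and of coloops. -/
lemma exists_series_class {α : Type*} {Q : Matroid α} {X : Set α} (hXfin : X.Finite)
    (hX : Q.Indep X) (hfin : (Q.contract X).eRank ≠ ⊤)
    (hr : (Q.delete X).eRank = (Q.contract X).eRank + 1) :
    ∃ C ⊆ X, C.Nonempty ∧ ∀ A ⊆ Q.E \ X, ∀ Y ⊆ X,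
      (Q.Indep (A ∪ Y) ↔ (C ⊆ Y ∧ Q.Indep (A ∪ X)) ∨ (¬ C ⊆ Y ∧ Q.Indep A)) := by
  classical
  set R := Q.contract (Q.E \ X) with hR
  have hRE : R.E = X := by simp [hR, hX.subset_ground]
  -- A base `D` of `R` together with a base of `Q \ X` is a base of `Q`. Comparing with `X` and a
  -- base of `Q / X` gives `|D| + 1 = |X|`.
  have hbasis : ∀ D, R.IsBase D → ∃ x ∈ X, D = X \ {x} := by
    intro D hD
    obtain ⟨B, hB⟩ := (Q.delete X).exists_isBase
    obtain ⟨B₀, hB₀⟩ := (Q.contract X).exists_isBase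
    rw [← hB.encard_eq_eRank, ← hB₀.encard_eq_eRank] at hr
    rw [← hB₀.encard_eq_eRank] at hfin
    have hBb : Q.IsBasis B (Q.E \ X) := Matroid.delete_isBase_iff.1 hB
    have hDX : D ⊆ X := hRE ▸ hD.subset_ground
    have hDB := (hBb.contract_indep_iff.1 hD.indep).1
    have hbase : Q.IsBase (D ∪ B) := by
      refine hDB.isBase_of_ground_subset_closure ?_
      rw [Matroid.closure_union_congr_right hBb.closure_eq_closure]
      intro e he
      by_cases heX : e ∈ X
      · have : e ∈ R.closure D := by rw [hD.closure_eq, hRE]; exact heX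
        rw [hR, Matroid.contract_closure_eq] at this
        exact this.1
      · exact Q.mem_closure_of_mem' (Or.inr ⟨he, heX⟩)
    have h2 := (hX.contract_isBase_iff.1 hB₀)
    have hcard := hbase.encard_eq_encard_of_isBase h2.1
    rw [Set.encard_union_eq, Set.encard_union_eq h2.2, hr] at hcard
    · have hDfin := hXfin.subset hDX
      have h3 : (X \ D).encard = 1 := by
        have h4 := Set.encard_sdiff_add_encard_of_subset hDX
        rw [← h4] at hcard
        lift B₀.encard to ℕ using hfin with b
        have h5 : (X \ D).encard ≠ ⊤ := (hXfin.subset Set.sdiff_subset).encard_lt_top.ne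
        lift (X \ D).encard to ℕ using h5 with c
        lift D.encard to ℕ using hDfin.encard_lt_top.ne with d
        norm_cast at hcard ⊢
        omega
      obtain ⟨x, hx⟩ := Set.encard_eq_one.1 h3
      refine ⟨x, (hx ▸ Set.mem_singleton x : x ∈ X \ D).1, ?_⟩
      rw [← hx, Set.sdiff_sdiff_cancel_left hDX]
    · exact Set.disjoint_left.2 fun e he he' => (hBb.subset he').2 (hDX he)
  have hAY : ∀ A ⊆ Q.E \ X, Q.Indep A → ∀ Y, R.Indep Y → Q.Indep (A ∪ Y) := by
    intro A hAE hA Y hY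
    obtain ⟨B, hB, hAB⟩ := hA.subset_isBasis_of_subset hAE
    refine (hB.contract_indep_iff.1 hY).1.subset ?_
    rw [Set.union_comm]
    exact Set.union_subset_union_right _ hAB
  set C := {x | x ∈ X ∧ R.Indep (X \ {x})} with hC
  have hcoloop : X \ C ⊆ Q.coloops := by
    intro y hy
    have : R.IsColoop y := by
      rw [Matroid.isColoop_iff_forall_mem_isBase]
      intro D hD
      obtain ⟨x, hx, rfl⟩ := hbasis D hD
      refine ⟨hy.1, fun h => hy.2 ?_⟩
      rw [Set.mem_singleton_iff.1 h]
      exact ⟨hx, hD.indep⟩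
    exact (Matroid.contract_isColoop_iff.1 this).1
  refine ⟨C, fun x hx => hx.1, ?_, fun A hA Y hY => ?_⟩
  · obtain ⟨D, hD⟩ := R.exists_isBase
    obtain ⟨x, hx, rfl⟩ := hbasis D hD
    exact ⟨x, hx, hD.indep⟩
  -- If `C ⊆ Y`, only coloops are missing from `Y`, so `Y` may be enlarged to `X`. Otherwise `Y`
  -- avoids some `x ∈ C` and is independent in `R`, hence imposes no condition on `A`.
  by_cases hCY : C ⊆ Y
  · simp only [hCY, true_and, not_true, false_and, or_false]
    refine ⟨fun h => ?_, fun h => h.subset (Set.union_subset_union_right _ hY)⟩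
    have := (Matroid.union_indep_iff_indep_of_subset_coloops (I := A ∪ Y) hcoloop).2 h
    refine this.subset ?_
    rw [Set.union_assoc]
    refine Set.union_subset_union_right _ fun x hx => ?_
    by_cases hxC : x ∈ C
    · exact Or.inl (hCY hxC)
    · exact Or.inr ⟨hx, hxC⟩
  · simp only [hCY, false_and, not_false_eq_true, true_and, false_or]
    refine ⟨fun h => h.subset Set.subset_union_left, fun h => ?_⟩
    obtain ⟨x, hxC, hxY⟩ := Set.not_subset.1 hCY
    exact hAY A hA h Y (hxC.2.subset fun e he => ⟨hY he, fun h' => hxY (h' ▸ he)⟩)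

lemma linearIndepOn_image_iff {K E F W : Type*} [Field K] [AddCommGroup W] [Module K W]
    {φ : F → W} {g : E → F} {A : Set E} (hg : Set.InjOn g A) :
    LinearIndepOn K φ (g '' A) ↔ LinearIndepOn K (φ ∘ g) A :=
  (linearIndependent_equiv' (Equiv.Set.imageOfInjOn g A hg) rfl).symm

lemma linearIndepOn_incidence_sum_inl {α β V : Type*} {p : V × V} {ends : α → V × V} {A : Set α} :
    LinearIndepOn (ZMod 2) (fun e : α ⊕ β => incidence (Sum.elim ends (fun _ => p) e))
      (Sum.inl '' A) ↔ LinearIndepOn (ZMod 2) (fun e => incidence (ends e)) A :=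
  linearIndepOn_image_iff Sum.inl_injective.injOn

lemma linearIndepOn_incidence_sum_insert_inr {α β V W : Type*} {p : V × V} {ends : α → V × V}
    {f : V → W} {s : W → V} (hne : p.1 ≠ p.2) (hf : f p.1 = f p.2)
    (hs : ∀ v, s (f v) = v ∨ v = p.1 ∧ s (f v) = p.2) {c : β} {A : Set α} :
    LinearIndepOn (ZMod 2) (fun e : α ⊕ β => incidence (Sum.elim ends (fun _ => p) e))
      (insert (Sum.inr c) (Sum.inl '' A)) ↔
        LinearIndepOn (ZMod 2) (fun e => incidence (f (ends e).1, f (ends e).2)) A := by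
  rw [linearIndepOn_incidence_insert_iff (ends := Sum.elim ends fun _ => p) (y := Sum.inr c) (f := f) (s := s)
    hne hf hs (by simp), linearIndepOn_image_iff Sum.inl_injective.injOn]
  rfl

/-- A graph that realizes the extension by a single element also realizes the one in which this
element is replaced by a series class `C` and a set of coloops. -/
lemma exists_ends_of_series_class {α β : Type*} {V : Type} [Finite V] {p : V × V} {ends : α → V × V}
    {V' : Type*} {f : V → V'} {s : V' → V} (hne : p.1 ≠ p.2) (hf : f p.1 = f p.2)
    (hs : ∀ v, s (f v) = v ∨ v = p.1 ∧ s (f v) = p.2) (C D : Finset β) (hC : C.Nonempty) (hdisj : Disjoint C D)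
    {M N : Set α → Prop}
    (hN : ∀ A, N A ↔ LinearIndepOn (ZMod 2) (fun e => incidence (ends e)) A)
    (hM : ∀ A, M A ↔ LinearIndepOn (ZMod 2)
      (fun e => incidence (f (ends e).1, f (ends e).2)) A) :
    ∃ (W : Type) (_ : Finite W) (ends' : α ⊕ β → W × W), ∀ (A : Set α) (Y : Set β),
      Y ⊆ ↑C ∪ ↑D → (LinearIndepOn (ZMod 2) (fun e => incidence (ends' e))
        (Sum.inl '' A ∪ Sum.inr '' Y) ↔ (↑C ⊆ Y ∧ M A) ∨ (¬ ↑C ⊆ Y ∧ N A)) := by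
  classical
  -- The outer induction adds the coloops as pendant edges; the inner one builds the path for `C`
  -- from the single edge `p`.
  induction D using Finset.induction_on with
  | insert y D hy ih =>
    rw [Finset.disjoint_insert_right] at hdisj
    obtain ⟨W, _, ends₁, h⟩ := ih hdisj.2
    obtain ⟨ends₂, h₂⟩ := exists_ends_coloop ends₁ (Sum.inr y)
    refine ⟨Option W, inferInstance, ends₂, fun A Y hY => ?_⟩
    have hset : (Sum.inl '' A ∪ Sum.inr '' Y) \ {Sum.inr y} =
        (Sum.inl '' A ∪ Sum.inr '' (Y \ {y}) : Set (α ⊕ β)) := by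
      ext (e | e) <;> simp
    have hCY : (C : Set β) ⊆ Y \ {y} ↔ (C : Set β) ⊆ Y :=
      ⟨fun h => h.trans Set.sdiff_subset,
        fun h => fun e he => ⟨h he, fun h' => hdisj.1 (h' ▸ he)⟩⟩
    rw [h₂, hset, h A (Y \ {y}), hCY]
    rintro e ⟨he, hey⟩
    have := hY he
    simp only [Finset.coe_insert, Set.mem_union, Set.mem_insert_iff] at this hey ⊢
    tauto
  | empty =>
    clear hdisj
    simp only [Finset.coe_empty, Set.union_empty]
    induction hC using Finset.Nonempty.cons_induction with
    | singleton c =>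
      refine ⟨V, inferInstance, Sum.elim ends fun _ => p, fun A Y hY => ?_⟩
      rw [Finset.coe_singleton] at hY ⊢
      rcases Set.subset_singleton_iff_eq.1 hY with rfl | rfl
      · simp only [Set.image_empty, Set.union_empty, Set.singleton_subset_iff,
          Set.mem_empty_iff_false, false_and, not_false_eq_true, true_and, false_or]
        rw [hN, linearIndepOn_incidence_sum_inl]
      · simp only [subset_refl, true_and, not_true, false_and, or_false, hM]
        rw [Set.image_singleton, Set.union_singleton,
          linearIndepOn_incidence_sum_insert_inr hne hf hs]
    | cons y C hy hC ih =>
      obtain ⟨W, _, ends₁, h⟩ := ih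
      obtain ⟨z, hz⟩ := hC
      have hyz : y ≠ z := fun h => hy (h ▸ hz)
      obtain ⟨ends₂, h₂⟩ := exists_ends_series ends₁ (y := Sum.inr y) (z := (Sum.inr z : α ⊕ β))
        (by simpa using hyz)
      refine ⟨Option W, inferInstance, ends₂, fun A Y hY => ?_⟩
      have hset : ∀ x, (Sum.inl '' A ∪ Sum.inr '' Y) \ {Sum.inr x} =
          (Sum.inl '' A ∪ Sum.inr '' (Y \ {x}) : Set (α ⊕ β)) := by
        intro x
        ext (e | e) <;> simp
      rw [Finset.coe_cons] at hY ⊢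
      by_cases hyY : y ∈ Y
      · rw [(h₂ _).1 (by simpa using hyY), hset, h A (Y \ {y})]
        · have hCY : (C : Set β) ⊆ Y \ {y} ↔ insert y (C : Set β) ⊆ Y := by
            rw [Set.insert_subset_iff]
            exact ⟨fun h => ⟨hyY, h.trans Set.sdiff_subset⟩,
              fun h => fun e he => ⟨h.2 he, fun h' => hy (h' ▸ he)⟩⟩
          rw [hCY]
        · rintro e ⟨he, hey⟩
          exact (hY he).resolve_left hey
      -- Without `y`, the enlarged class is not contained in `Y`, nor `C` in `Y \ {z}`; both
      -- descriptions reduce to `N A`.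
      · rw [(h₂ _).2 (by simpa using hyY), hset, h A (Y \ {z})]
        · have h1 : ¬ (C : Set β) ⊆ Y \ {z} := fun h => (h hz).2 rfl
          have h2 : ¬ insert y (C : Set β) ⊆ Y := fun h => hyY (h (Set.mem_insert _ _))
          simp [h1, h2]
        · rintro e ⟨he, -⟩
          exact (hY he).resolve_left fun h => hyY (h ▸ he)

/-! ### Lifts from linear maps, and witnesses -/

lemma mem_closure_vectorMatroid_iff {K E W : Type*} [Field K] [AddCommGroup W] [Module K W]
    [Finite E] {φ : E → W} {F : Set E} {e : E} :
    e ∈ (vectorMatroid K φ).closure F ↔ φ e ∈ Submodule.span K (φ '' F) := by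
  have key : ∀ I e, LinearIndepOn K φ I →
      (e ∈ (vectorMatroid K φ).closure I ↔ φ e ∈ Submodule.span K (φ '' I)) := by
    intro I e hI
    have hI' : (vectorMatroid K φ).Indep I := hI
    rw [hI'.mem_closure_iff', vectorMatroid_indep_iff]
    by_cases he : e ∈ I
    · simpa [he] using Submodule.subset_span (Set.mem_image_of_mem φ he)
    · rw [linearIndepOn_insert he]
      simp [he, hI]
  obtain ⟨I, hI⟩ := (vectorMatroid K φ).exists_isBasis F
  rw [← hI.closure_eq_closure, key I e hI.indep]
  have : Submodule.span K (φ '' F) = Submodule.span K (φ '' I) := by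
    refine le_antisymm (Submodule.span_le.2 ?_) (Submodule.span_mono (Set.image_mono hI.subset))
    rintro _ ⟨f, hf, rfl⟩
    exact (key I f hI.indep).1 (hI.subset_closure hf)
  rw [this]

/-- Closure is membership in a span, and linear maps preserve such membership; hence a set closed
after `L` is closed before it. -/
lemma isLift_vectorMatroid_comp {K E U W : Type*} [Field K] [AddCommGroup U] [Module K U]
    [AddCommGroup W] [Module K W] [Finite E] (φ : E → U) (L : U →ₗ[K] W) :
    IsLift (vectorMatroid K φ) (vectorMatroid K (L ∘ φ)) := by
  refine ⟨rfl, fun F hF => ?_⟩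
  rw [Matroid.isFlat_iff_closure_eq] at hF ⊢
  refine subset_antisymm (fun e he => ?_) ((vectorMatroid K φ).subset_closure F)
  rw [mem_closure_vectorMatroid_iff] at he
  rw [← hF, mem_closure_vectorMatroid_iff, Set.image_comp, Submodule.span_image]
  exact Submodule.mem_map_of_mem he

/-- The cycle matroid of the graph in which the edge `e` has the ends `ends e`. -/
noncomputable def cycleMatroid {E V : Type*} [Finite E] (ends : E → V × V) : Matroid E :=
  vectorMatroid (ZMod 2) fun e => incidence (ends e)

@[simp] lemma cycleMatroid_ground {E V : Type*} [Finite E] (ends : E → V × V) :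
    (cycleMatroid ends).E = Set.univ := rfl

lemma cycleMatroid_indep_iff {E V : Type*} [Finite E] {ends : E → V × V} {I : Set E} :
    (cycleMatroid ends).Indep I ↔ LinearIndepOn (ZMod 2) (fun e => incidence (ends e)) I := Iff.rfl

lemma isCycleMatroid_cycleMatroid {E V : Type*} [Finite E] {ends : E → V × V} {G : Graph V E}
    (hG : ∀ e, G.IsLink e (ends e).1 (ends e).2) : IsCycleMatroid G (cycleMatroid ends) := by
  have hE : G.edgeSet = Set.univ := Set.eq_univ_of_forall fun e => (hG e).edge_mem
  exact ⟨hE.symm, fun I hI => (forall_not_isCycle_iff (fun e _ => hG e) hI).symm⟩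

lemma isLift_cycleMatroid_map {E V W : Type*} [Finite E] (ends : E → V × V) (f : V → W) :
    IsLift (cycleMatroid ends) (cycleMatroid fun e => (f (ends e).1, f (ends e).2)) := by
  have := isLift_vectorMatroid_comp (fun e => incidence (ends e))
    (Finsupp.lmapDomain (ZMod 2) (ZMod 2) f)
  simpa only [Function.comp_def, lmapDomain_incidence, cycleMatroid] using this

attribute [irreducible] cycleMatroid

/-- Deletion and contraction fix which `A` and `A ∪ X` are independent. With the series class this
fixes all of `Q`, and the graph built from `p` obeys the same rule. -/
lemma isGraphic_of_witness {α β V' : Type*} [Finite α] {V : Type} [Finite V] {p : V × V}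
    {ends : α → V × V} {f : V → V'} {s : V' → V} (hne : p.1 ≠ p.2) (hf : f p.1 = f p.2)
    (hs : ∀ v, s (f v) = v ∨ v = p.1 ∧ s (f v) = p.2)
    (hr : (cycleMatroid ends).eRank =
      (cycleMatroid fun e => (f (ends e).1, f (ends e).2)).eRank + 1)
    {X : Set β} {Q : Matroid (α ⊕ β)} (hX : X.Finite)
    (hE : Q.E = Sum.inl '' (Set.univ : Set α) ∪ Sum.inr '' X) (hQX : Q.Indep (Sum.inr '' X))
    (hcon : Q.contract (Sum.inr '' X) = (cycleMatroid fun e =>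
      (f (ends e).1, f (ends e).2)).map Sum.inl Sum.inl_injective.injOn)
    (hdel : Q.delete (Sum.inr '' X) = (cycleMatroid ends).map Sum.inl Sum.inl_injective.injOn) :
    IsGraphic Q := by
  classical
  have hEX : Q.E \ Sum.inr '' X = Sum.inl '' (Set.univ : Set α) := by
    rw [hE]
    ext (e | e) <;> simp
  have hN : ∀ A : Set α, Q.Indep (Sum.inl '' A) ↔ (cycleMatroid ends).Indep A := by
    intro A
    have h : (Q.delete (Sum.inr '' X)).Indep (Sum.inl '' A) ↔ Q.Indep (Sum.inl '' A) := by
      rw [Matroid.delete_indep_iff]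
      refine and_iff_left (Set.disjoint_left.2 ?_)
      rintro _ ⟨a, -, rfl⟩ ⟨b, -, h⟩
      simp at h
    rw [← h, hdel, Matroid.map_image_indep_iff (by simp)]
  have hM : ∀ A : Set α, Q.Indep (Sum.inl '' A ∪ Sum.inr '' X) ↔
      (cycleMatroid fun e => (f (ends e).1, f (ends e).2)).Indep A := by
    intro A
    have h : (Q.contract (Sum.inr '' X)).Indep (Sum.inl '' A) ↔
        Q.Indep (Sum.inl '' A ∪ Sum.inr '' X) := by
      rw [hQX.contract_indep_iff]
      refine and_iff_right (Set.disjoint_left.2 ?_)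
      rintro _ ⟨a, -, rfl⟩ ⟨b, -, h⟩
      simp at h
    rw [← h, hcon, Matroid.map_image_indep_iff (by simp)]
  obtain ⟨C', hC'X, hC'ne, hC'⟩ := exists_series_class (hX.image Sum.inr) hQX
    (by
      rw [hcon, Matroid.eRank_map]
      exact ne_top_of_le_ne_top (Set.toFinite _).encard_lt_top.ne
        (Matroid.eRank_le_encard_ground _))
    (by rw [hcon, hdel, Matroid.eRank_map, Matroid.eRank_map, hr])
  obtain ⟨C, hCX, rfl⟩ := Set.subset_image_iff.1 hC'X
  rw [hEX] at hC'
  lift X to Finset β using hX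
  lift C to Finset β using X.finite_toSet.subset hCX
  have hCX' : C ⊆ X := Finset.coe_subset.1 hCX
  obtain ⟨W, _, ends', h⟩ := exists_ends_of_series_class hne hf hs C (X \ C)
    (by simpa using hC'ne) Finset.disjoint_sdiff (fun A => cycleMatroid_indep_iff (ends := ends))
    (fun A => cycleMatroid_indep_iff (ends := fun e => (f (ends e).1, f (ends e).2)))
  refine isGraphic_of_linearIndepOn ends' fun I hI => ?_
  obtain ⟨A, Y, rfl⟩ : ∃ (A : Set α) (Y : Set β), I = Sum.inl '' A ∪ Sum.inr '' Y :=
    ⟨Sum.inl ⁻¹' I, Sum.inr ⁻¹' I, (Set.image_preimage_inl_union_image_preimage_inr I).symm⟩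
  have hYX : Y ⊆ X := by
    intro y hy
    have := hE ▸ hI (Or.inr ⟨y, hy, rfl⟩)
    simpa using this
  rw [h A Y (by rwa [Finset.coe_sdiff, Set.union_sdiff_cancel hCX]),
    hC' _ (Set.image_mono (Set.subset_univ A)) _ (Set.image_mono hYX), hN, hM,
    Set.image_subset_image_iff Sum.inr_injective]

lemma exists_witness {α V V' : Type*} [Finite α] {p : V × V}
    {ends : α → V × V} {f : V → V'} {s : V' → V} (hne : p.1 ≠ p.2) (hf : f p.1 = f p.2)
    (hs : ∀ v, s (f v) = v ∨ v = p.1 ∧ s (f v) = p.2) :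
    ∃ Q : Matroid (α ⊕ Unit), Q.E = Sum.inl '' (Set.univ : Set α) ∪ Sum.inr '' {()} ∧
      Q.Indep (Sum.inr '' {()}) ∧
      Q.contract (Sum.inr '' {()}) = (cycleMatroid fun e =>
        (f (ends e).1, f (ends e).2)).map Sum.inl Sum.inl_injective.injOn ∧
      Q.delete (Sum.inr '' {()}) =
        (cycleMatroid ends).map Sum.inl Sum.inl_injective.injOn := by
  have hind : (cycleMatroid (Sum.elim ends fun _ : Unit => p)).Indep (Sum.inr '' {()}) := by
    rw [Set.image_singleton, cycleMatroid_indep_iff]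
    exact LinearIndepOn.singleton (incidence_ne_zero hne)
  have hE : (Set.univ : Set (α ⊕ Unit)) \ Sum.inr '' {()} = Sum.inl '' (Set.univ : Set α) := by
    ext (e | e) <;> simp
  refine ⟨cycleMatroid (Sum.elim ends fun _ => p), ?_, hind, ?_, ?_⟩
  · ext (e | e) <;> simp
  · refine Matroid.ext_indep (by simpa using hE) fun I hI => ?_
    rw [Matroid.contract_ground, cycleMatroid_ground, hE] at hI
    obtain ⟨A, -, rfl⟩ := Set.subset_image_iff.1 hI
    rw [Matroid.map_image_indep_iff (by simp), hind.contract_indep_iff, Set.image_singleton,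
      Set.union_singleton, cycleMatroid_indep_iff,
      linearIndepOn_incidence_sum_insert_inr hne hf hs, cycleMatroid_indep_iff]
    simp
  · refine Matroid.ext_indep (by simpa using hE) fun I hI => ?_
    rw [Matroid.delete_ground, cycleMatroid_ground, hE] at hI
    obtain ⟨A, -, rfl⟩ := Set.subset_image_iff.1 hI
    rw [Matroid.map_image_indep_iff (by simp), Matroid.delete_indep_iff, cycleMatroid_indep_iff,
      linearIndepOn_incidence_sum_inl, cycleMatroid_indep_iff]
    simp

/-! ### Parallel pairs and triangles in an arbitrary graph of a matroid -/

section Cycles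

variable {V E : Type*} {G : Graph V E} {M : Matroid E}

lemma IsCycleMatroid.exists_isCycle (h : IsCycleMatroid G M) {I : Set E} (hI : ¬ M.Indep I)
    (hIE : I ⊆ M.E) : ∃ C ⊆ I, IsCycle G C := by
  rw [h.2 I (h.1 ▸ hIE)] at hI
  push Not at hI
  exact hI

lemma IsCycleMatroid.ne_of_isLink (h : IsCycleMatroid G M) {e : E} {x y : V} (he : M.Indep {e})
    (hl : G.IsLink e x y) : x ≠ y := by
  rintro rfl
  refine (h.2 {e} (by simpa using hl.edge_mem)).1 he {e} subset_rfl
    ⟨0, fun _ => x, fun _ => e, fun i j _ => Fin.ext (by omega), fun i j _ => Fin.ext (by omega),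
      fun _ => hl, by simp⟩

lemma IsCycleMatroid.not_isLink_of_isLink (h : IsCycleMatroid G M) {e f : E} {x y : V}
    (hef : e ≠ f) (hind : M.Indep {e, f}) (he : G.IsLink e x y) : ¬ G.IsLink f x y := by
  intro hf
  have hxy : x ≠ y := h.ne_of_isLink (hind.subset (by simp)) he
  refine (h.2 {e, f} (by simp [Set.insert_subset_iff, he.edge_mem, hf.edge_mem])).1 hind {e, f}
    subset_rfl ⟨1, ![x, y], ![e, f], ?_, ?_, ?_, ?_⟩
  · intro i j
    fin_cases i <;> fin_cases j <;> simp [hxy, hxy.symm]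
  · intro i j
    fin_cases i <;> fin_cases j <;> simp [hef, hef.symm]
  · intro i
    fin_cases i
    · exact he
    · exact hf.symm
  · simp [Set.pair_comm]

lemma IsCycleMatroid.exists_isLink_of_pair (h : IsCycleMatroid G M) {a b : E} (hab : a ≠ b)
    (hE : {a, b} ⊆ M.E) (ha : M.Indep {a}) (hb : M.Indep {b}) (hdep : ¬ M.Indep {a, b}) :
    ∃ x y, G.IsLink a x y ∧ G.IsLink b x y := by
  obtain ⟨C, hC, hcyc⟩ := h.exists_isCycle hdep hE
  have hno : ∀ c, M.Indep c → ¬ C ⊆ c := fun c hc hCc =>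
    (h.2 c (h.1 ▸ hc.subset_ground)).1 hc C hCc hcyc
  have hCab : C = {a, b} := by
    have h1 := hno _ ha
    have h2 := hno _ hb
    grind
  obtain ⟨n, v, e, hv, he, hl, rfl⟩ := hcyc
  have hn : n = 1 := by
    have := Set.ncard_range_of_injective he
    rw [hCab, Set.ncard_pair hab, Nat.card_fin] at this
    omega
  subst hn
  obtain ⟨i, rfl⟩ : a ∈ Set.range e := by simp [hCab]
  obtain ⟨j, rfl⟩ : b ∈ Set.range e := by simp [hCab]
  have h0 := hl 0
  have h1 := (hl 1).symm
  fin_cases i <;> fin_cases j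
  · exact absurd rfl hab
  · exact ⟨_, _, h0, h1⟩
  · exact ⟨_, _, h1, h0⟩
  · exact absurd rfl hab

/-- Independence of the pairs forces the cycle inside the triple to be all of it; the six cases are
the ways to place the labels along the cycle. -/
lemma IsCycleMatroid.exists_isLink_of_triangle (h : IsCycleMatroid G M) {a b c : E}
    (hE : {a, b, c} ⊆ M.E) (hab : M.Indep {a, b}) (hac : M.Indep {a, c}) (hbc : M.Indep {b, c})
    (hdep : ¬ M.Indep {a, b, c}) :
    ∃ x y z, G.IsLink a y z ∧ G.IsLink b x z ∧ G.IsLink c x y := by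
  obtain ⟨C, hC, hcyc⟩ := h.exists_isCycle hdep hE
  have hno : ∀ c, M.Indep c → ¬ C ⊆ c := fun c hc hCc =>
    (h.2 c (h.1 ▸ hc.subset_ground)).1 hc C hCc hcyc
  have hne : a ≠ b ∧ a ≠ c ∧ b ≠ c := by
    refine ⟨?_, ?_, ?_⟩ <;> rintro rfl <;> simp_all
  have hCabc : C = {a, b, c} := by
    have h1 := hno _ hab
    have h2 := hno _ hac
    have h3 := hno _ hbc
    grind
  obtain ⟨n, v, e, hv, he, hl, rfl⟩ := hcyc
  have hn : n = 2 := by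
    have := Set.ncard_range_of_injective he
    rw [hCabc, Set.ncard_eq_three.2 ⟨a, b, c, hne.1, hne.2.1, hne.2.2, rfl⟩, Nat.card_fin] at this
    omega
  subst hn
  obtain ⟨i, rfl⟩ : a ∈ Set.range e := by simp [hCabc]
  obtain ⟨j, rfl⟩ : b ∈ Set.range e := by simp [hCabc]
  obtain ⟨k, rfl⟩ : c ∈ Set.range e := by simp [hCabc]
  have h0 : G.IsLink (e 0) (v 0) (v 1) := hl 0
  have h1 : G.IsLink (e 1) (v 1) (v 2) := hl 1
  have h2 : G.IsLink (e 2) (v 2) (v 0) := hl 2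
  obtain ⟨n1, n2, n3⟩ := hne
  fin_cases i <;> fin_cases j <;> fin_cases k <;> first
    | exact absurd rfl n1
    | exact absurd rfl n2
    | exact absurd rfl n3
    | skip
  · exact ⟨_, _, _, h0, h1.symm, h2⟩
  · exact ⟨_, _, _, h0.symm, h2, h1.symm⟩
  · exact ⟨_, _, _, h1.symm, h0, h2.symm⟩
  · exact ⟨_, _, _, h1, h2.symm, h0⟩
  · exact ⟨_, _, _, h2, h0.symm, h1⟩
  · exact ⟨_, _, _, h2.symm, h1, h0.symm⟩

end Cycles

/-! ### The three concrete matroids -/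

/-- Independence in a cycle matroid, checked on all subsets: no nonempty subset meets every vertex
evenly. -/
lemma cycleMatroid_indep_coe_iff {E V : Type*} [Finite E] [DecidableEq V]
    {ends : E → V × V} {S : Finset E} : (cycleMatroid ends).Indep (S : Set E) ↔
      ∀ T ∈ S.powerset, (∀ v, ∑ e ∈ T, ((if (ends e).1 = v then 1 else 0) +
        (if (ends e).2 = v then 1 else 0) : ZMod 2) = 0) → T = ∅ := by
  rw [cycleMatroid_indep_iff, linearIndepOn_zmod_two_iff]
  refine forall_congr' fun T => ?_
  rw [Finset.mem_powerset, Finset.coe_subset]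
  simp only [Finsupp.ext_iff, Finsupp.finsetSum_apply, incidence_apply, Finsupp.coe_zero,
    Pi.zero_apply]

instance {E V : Type*} [Finite E] [DecidableEq E] [Fintype V] [DecidableEq V] (ends : E → V × V)
    (S : Finset E) : Decidable ((cycleMatroid ends).Indep (S : Set E)) :=
  decidable_of_iff' _ cycleMatroid_indep_coe_iff

lemma eRank_cycleMatroid_eq {E V : Type*} [Finite E] [DecidableEq E] {ends : E → V × V}
    (B : Finset E) (hB : (cycleMatroid ends).Indep (B : Set E))
    (hmax : ∀ e ∉ B, ¬ (cycleMatroid ends).Indep ((insert e B : Finset E) : Set E)) :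
    (cycleMatroid ends).eRank = B.card := by
  have : (cycleMatroid ends).IsBase (B : Set E) := by
    refine hB.isBase_of_forall_insert fun e he => ?_
    simpa using hmax e (by simpa using he.2)
  rw [← this.encard_eq_eRank, Set.encard_coe_eq_coe_finsetCard]

/-- The ends of the edges of `graphH1`. -/
def endsH1 : Fin 9 → Fin 3 × Fin 3 :=
  ![(0, 2), (0, 1), (0, 0), (1, 2), (1, 2), (1, 2), (0, 2), (0, 2), (0, 1)]

/-- The ends of the edges of `graphH2`. -/
def endsH2 : Fin 9 → Fin 4 × Fin 4 :=
  ![(0, 3), (0, 1), (0, 0), (1, 2), (1, 3), (1, 3), (0, 2), (0, 2), (0, 1)]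

/-- The ends of the edges of `graphG3`. -/
def endsG3 : Fin 9 → Fin 5 × Fin 5 :=
  ![(0, 1), (0, 4), (2, 4), (0, 3), (1, 2), (1, 4), (3, 4), (2, 3), (0, 2)]

/-- The identification of the vertices `2` and `3` of `graphH2`. -/
def identifyH2 : Fin 4 → Fin 3 := ![0, 1, 2, 2]

/-- The identification of the vertices `2` and `4` of `graphG3`. -/
def identifyG3 : Fin 5 → Fin 4 := ![0, 1, 2, 3, 2]

/-- The section picks 2 in the merged class, so 3 is the only vertex it moves. -/
lemma identifyH2_section (v : Fin 4) : (![0, 1, 2] : Fin 3 → Fin 4) (identifyH2 v) = v ∨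
    v = ((3, 2) : Fin 4 × Fin 4).1 ∧
      (![0, 1, 2] : Fin 3 → Fin 4) (identifyH2 v) = ((3, 2) : Fin 4 × Fin 4).2 := by
  revert v; decide

lemma identifyG3_section (v : Fin 5) : (![0, 1, 2, 3] : Fin 4 → Fin 5) (identifyG3 v) = v ∨
    v = ((4, 2) : Fin 5 × Fin 5).1 ∧
      (![0, 1, 2, 3] : Fin 4 → Fin 5) (identifyG3 v) = ((4, 2) : Fin 5 × Fin 5).2 := by
  revert v; decide

lemma cycleMatroid_endsH1 : cycleMatroid endsH1 =
    cycleMatroid fun e => (identifyH2 (endsH2 e).1, identifyH2 (endsH2 e).2) := by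
  congr 1
  decide

lemma linearCombination_incidence {V W : Type*} [AddCommGroup W] [Module (ZMod 2) W] (w : V → W)
    (p : V × V) : Finsupp.linearCombination (ZMod 2) w (incidence p) = w p.1 + w p.2 := by
  simp [incidence]

/-- The Whitney twist: `graphH2` and the graph obtained from `graphG3` by identifying `2` and `4`
have the same cycle matroid. -/
lemma cycleMatroid_endsH2 : cycleMatroid endsH2 =
    cycleMatroid fun e => (identifyG3 (endsG3 e).1, identifyG3 (endsG3 e).2) := by
  refine Matroid.ext_indep (by simp only [cycleMatroid_ground]) fun I _ => ?_
  rw [cycleMatroid_indep_iff, cycleMatroid_indep_iff]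
  constructor
  -- The twist in linear form, from `G₂` to `H₂`: the piece at vertex 3 is turned around the
  -- separating pair 0, 2. Adding the images of both to the image of 3 exchanges its edges to 0 with
  -- those to 2.
  · let w : Fin 4 → Fin 4 →₀ ZMod 2 := ![.single 0 1, .single 3 1, .single 1 1,
      .single 0 1 + .single 1 1 + .single 2 1]
    intro h
    refine LinearIndepOn.of_comp (Finsupp.linearCombination (ZMod 2) w) ?_
    convert! h using 2 with e
    simp only [Function.comp, linearCombination_incidence]
    ext v
    simp only [incidence_apply, w]
    revert e v
    simp only [Fin.forall_fin_succ, IsEmpty.forall_iff]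
    simp [endsH2, endsG3, identifyG3]
    decide
  · let w : Fin 4 → Fin 4 →₀ ZMod 2 := ![.single 0 1, .single 2 1,
      .single 3 1 + .single 0 1 + .single 2 1, .single 1 1]
    intro h
    refine LinearIndepOn.of_comp (Finsupp.linearCombination (ZMod 2) w) ?_
    convert! h using 2 with e
    simp only [Function.comp, linearCombination_incidence]
    ext v
    simp only [incidence_apply, w]
    revert e v
    simp only [Fin.forall_fin_succ, IsEmpty.forall_iff]
    simp [endsH2, endsG3, identifyG3]
    decide

lemma eRank_cycleMatroid_endsH1 : (cycleMatroid endsH1).eRank = 2 :=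
  eRank_cycleMatroid_eq {0, 1} (by decide) (by decide)

lemma eRank_cycleMatroid_endsH2 : (cycleMatroid endsH2).eRank = 3 :=
  eRank_cycleMatroid_eq {0, 1, 6} (by decide) (by decide)

lemma eRank_cycleMatroid_endsG3 : (cycleMatroid endsG3).eRank = 4 :=
  eRank_cycleMatroid_eq {0, 1, 3, 8} (by decide) (by decide)

/-! ### The flag is not graphic -/

/-- A graph with the cycle matroid of `graphG3` cannot be turned into one with the cycle matroid of
`graphH1` by identifying vertices. -/
lemma not_isCycleMatroid_map {V W : Type*} {G : Graph V (Fin 9)} {f : V → W}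
    (hG : IsCycleMatroid G (cycleMatroid endsG3))
    (hf : IsCycleMatroid (G.map f) (cycleMatroid endsH1)) : False := by
  have pair : ∀ a b : Fin 9, (cycleMatroid endsG3).Indep {a, b} := by
    intro a b
    have : ∀ a b : Fin 9, (cycleMatroid endsG3).Indep (({a, b} : Finset (Fin 9)) : Set (Fin 9)) := by
      decide
    simpa using this a b
  have tri : ∀ a b c : Fin 9,
      ¬ (cycleMatroid endsG3).Indep (({a, b, c} : Finset (Fin 9)) : Set (Fin 9)) →
      ∃ x y z, G.IsLink a y z ∧ G.IsLink b x z ∧ G.IsLink c x y := by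
    intro a b c h
    exact hG.exists_isLink_of_triangle (by simp) (pair a b) (pair a c) (pair b c) (by simpa using h)
  have npar : ∀ a b : Fin 9, a ≠ b → ∀ x y, G.IsLink a x y → ¬ G.IsLink b x y :=
    fun a b hab x y => hG.not_isLink_of_isLink hab (pair a b)
  have single : ∀ a : Fin 9, a ≠ 2 → (cycleMatroid endsH1).Indep {a} := by
    have : ∀ a : Fin 9, a ≠ 2 →
        (cycleMatroid endsH1).Indep (({a} : Finset (Fin 9)) : Set (Fin 9)) := by decide
    simpa using this
  have nloop : ∀ a : Fin 9, a ≠ 2 → ∀ x y, G.IsLink a x y → f x ≠ f y :=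
    fun a ha x y h => hf.ne_of_isLink (single a ha) (h.map f)
  -- The vertices `u`, `v`, `w` play the roles of 0, 4, 3 in `G₃`.
  obtain ⟨w, v, u, h1, h3, h6⟩ := tri 1 3 6 (by decide)
  -- Otherwise 0 meets 1 at `v`, and 5 joins `u` to the other end of 0. Edge 8 shares a triangle,
  -- hence a vertex, with each of 0, 1, 3, so it would be parallel to 1, 5 or 6.
  have h0 : ∃ z, G.IsLink 0 u z := by
    by_contra hu
    obtain ⟨a, b, c, h0, h1', h5⟩ := tri 0 1 5 (by decide)
    obtain ⟨rfl, rfl⟩ : a = u ∧ c = v := by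
      rcases h1.eq_and_eq_or_eq_and_eq h1' with h | ⟨h, h'⟩
      · exact absurd ⟨b, h.2 ▸ h0.symm⟩ hu
      · exact ⟨h'.symm, h.symm⟩
    obtain ⟨d, p, q, h8, h1'', -⟩ := tri 8 1 2 (by decide)
    obtain ⟨d', p', q', h8', h3', -⟩ := tri 8 3 7 (by decide)
    obtain ⟨d'', p'', q'', h8'', h0', -⟩ := tri 8 0 4 (by decide)
    have k1 := h1.eq_and_eq_or_eq_and_eq h1''
    have k3 := h3.eq_and_eq_or_eq_and_eq h3'
    have k0 := h0.eq_and_eq_or_eq_and_eq h0'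
    have k8' := h8.eq_and_eq_or_eq_and_eq h8'
    have k8'' := h8.eq_and_eq_or_eq_and_eq h8''
    have m1 := npar 8 1 (by decide) p q h8
    have m5 := npar 8 5 (by decide) p q h8
    have m6 := npar 8 6 (by decide) p q h8
    have m1' := fun h => m1 (Graph.IsLink.symm h)
    have m5' := fun h => m5 (Graph.IsLink.symm h)
    have m6' := fun h => m6 (Graph.IsLink.symm h)
    have n1 := nloop 1 (by decide) _ _ h1
    have n3 := nloop 3 (by decide) _ _ h3
    have n6 := nloop 6 (by decide) _ _ h6
    have n5 := nloop 5 (by decide) _ _ h5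
    have n0 := nloop 0 (by decide) _ _ h0
    grind
  obtain ⟨z, h0⟩ := h0
  -- Edges 0 and 6 are parallel after the identification, so `f u` is `f v` or `f w`, against 1 and
  -- 3 being nonloops.
  obtain ⟨x, y, hx0, hx6⟩ := hf.exists_isLink_of_pair (a := 0) (b := 6) (by decide) (by simp)
    (single 0 (by decide)) (single 6 (by decide)) (by
      have : ¬ (cycleMatroid endsH1).Indep (({0, 6} : Finset (Fin 9)) : Set (Fin 9)) := by decide
      simpa using this)
  have n1 := nloop 1 (by decide) _ _ h1
  have n3 := nloop 3 (by decide) _ _ h3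
  have e0 := hx0.eq_and_eq_or_eq_and_eq (h0.map f)
  have e6 := hx6.eq_and_eq_or_eq_and_eq (h6.map f)
  grind

end FlagMatroid

open FlagMatroid in
theorem mainTheorem9 :
    ∃ M : Fin 3 → Matroid (Fin 9),
      FlagMatroid.IsCycleMatroid FlagMatroid.graphH1 (M 0) ∧
      FlagMatroid.IsCycleMatroid FlagMatroid.graphH2 (M 1) ∧
      FlagMatroid.IsCycleMatroid FlagMatroid.graphG3 (M 2) ∧
      FlagMatroid.IsFullFlagMatroid M ∧
      (∃ (β : Type) (X : Fin 2 → Set β) (Q : Fin 2 → Matroid (Fin 9 ⊕ β)),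
        FlagMatroid.IsLiftWitnessSeq M X Q) ∧
      (∀ (β : Type*) (X : Fin 2 → Set β) (Q : Fin 2 → Matroid (Fin 9 ⊕ β)),
        FlagMatroid.IsLiftWitnessSeq M X Q → ∀ i, FlagMatroid.IsGraphic (Q i)) ∧
      ¬ FlagMatroid.IsGraphicFlagMatroid M := by
  have lift₀ : IsLift (cycleMatroid endsH2) (cycleMatroid endsH1) := by
    rw [cycleMatroid_endsH1]
    exact isLift_cycleMatroid_map endsH2 identifyH2
  have lift₁ : IsLift (cycleMatroid endsG3) (cycleMatroid endsH2) := by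
    rw [cycleMatroid_endsH2]
    exact isLift_cycleMatroid_map endsG3 identifyG3
  have rank₀ : (cycleMatroid endsH2).eRank = (cycleMatroid endsH1).eRank + 1 := by
    rw [eRank_cycleMatroid_endsH2, eRank_cycleMatroid_endsH1]; rfl
  have rank₁ : (cycleMatroid endsG3).eRank = (cycleMatroid endsH2).eRank + 1 := by
    rw [eRank_cycleMatroid_endsH2, eRank_cycleMatroid_endsG3]; rfl
  refine ⟨![cycleMatroid endsH1, cycleMatroid endsH2, cycleMatroid endsG3],
    isCycleMatroid_cycleMatroid ?_, isCycleMatroid_cycleMatroid ?_,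
    isCycleMatroid_cycleMatroid ?_, ⟨⟨?_, ?_, ?_⟩, ?_⟩, ?_, ?_, ?_⟩
  · intro e; fin_cases e <;> rfl
  · intro e; fin_cases e <;> rfl
  · intro e; fin_cases e <;> rfl
  · exact fun i => Set.toFinite _
  · intro i
    fin_cases i
    · exact lift₀
    · exact lift₁
  · intro i h
    have h' := congrArg Matroid.eRank h
    fin_cases i
    · exact absurd (eRank_cycleMatroid_endsH2.symm.trans (h'.trans eRank_cycleMatroid_endsH1))
        (by decide)
    · exact absurd (eRank_cycleMatroid_endsG3.symm.trans (h'.trans eRank_cycleMatroid_endsH2))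
        (by decide)
  · intro i
    fin_cases i
    · exact rank₀
    · exact rank₁
  · obtain ⟨Q₀, hE₀, hX₀, hc₀, hd₀⟩ := exists_witness (p := (3, 2)) (ends := endsH2)
      (by decide) (by decide) identifyH2_section
    obtain ⟨Q₁, hE₁, hX₁, hc₁, hd₁⟩ := exists_witness (p := (4, 2)) (ends := endsG3)
      (by decide) (by decide) identifyG3_section
    simp only [← cycleMatroid_endsH1, ← cycleMatroid_endsH2] at hc₀ hc₁
    refine ⟨Unit, fun _ => {()}, ![Q₀, Q₁], fun i => Set.toFinite _, ?_, ?_, ?_, ?_⟩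
    · intro i; fin_cases i; exacts [hE₀.trans (by simp), hE₁.trans (by simp)]
    · intro i; fin_cases i; exacts [hX₀, hX₁]
    · intro i; fin_cases i; exacts [hc₀, hc₁]
    · intro i; fin_cases i; exacts [hd₀, hd₁]
  · intro β X Q h i
    have hg := h.ground i
    have hc := h.contract i
    have hd := h.delete i
    fin_cases i
    · exact isGraphic_of_witness (p := (3, 2)) (ends := endsH2) (by decide) (by decide)
        identifyH2_section (cycleMatroid_endsH1 ▸ rank₀) (h.finite 0) (hg.trans (by simp)) (h.indep 0)
        (hc.trans (by simp [cycleMatroid_endsH1])) hd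
    · exact isGraphic_of_witness (p := (4, 2)) (ends := endsG3) (by decide) (by decide)
        identifyG3_section (cycleMatroid_endsH2 ▸ rank₁) (h.finite 1) (hg.trans (by simp)) (h.indep 1)
        (hc.trans (by simp [cycleMatroid_endsH2])) hd
  · rintro ⟨V, _, G, P, hP, hM⟩
    have h0 := hM 0
    have h2 := hM 2
    -- Only the extreme partitions matter: the obstruction lies between `M(G₃)` and `M(H₁)`.
    have hle : P 2 ≤ P 0 := (hP 1).trans (hP 0)
    have hmap : (G.map (Quotient.mk (P 2))).map (Quotient.map' id hle) =
        G.map (Quotient.mk (P 0)) := by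
      rw [Graph.map_map]; rfl
    rw [← hmap] at h0
    exact not_isCycleMatroid_map h2 h0
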